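/- Let $a<b$ be real numbers, let $\alpha>0$ with $\alpha\neq 1$, and let $\psi\in C^1([a,b],\mathbb R)$ be increasing with $\psi'(t)\neq 0$ for all $t\in[a,b]$. Write $D_t^{n;\psi}=\bigl(\tfrac1{\psi'(t)}\tfrac{d}{dt}\bigr)^n$. Let $\eta(x,t,u)$, defined for $x\in\mathbb R$, $t\in(a,b)$, $u\in\mathbb R$, be a $C^\infty$ function of the variables $(x,\psi(t),u)$. For a function $u=u(x,t)$ on $\mathbb R\times[a,b]$ that is a $C^\infty$ function of $(x,\psi(t))$, and for $x\in\mathbb R$, $t\in(a,b)$, consider the series $$\mu=\sum_{m=2}^{\infty}\sum_{n=2}^{m}\sum_{k=2}^{n}\sum_{r=0}^{k-1}\binom{\alpha}{m}\binom{m}{n}\binom{k}{r}\frac1{k!}\,\frac{(\psi(t)-\psi(a))^{m-\alpha}}{\Gamma(m+1-\alpha)}\,[-u]^{r}\,D_t^{n;\psi}\bigl(u^{k-r}\bigr)\,\frac{\partial^{m-n+k;\psi}\eta}{\partial t^{m-n;\psi}\,\partial u^{k}},$$ where $\partial^{m-n+k;\psi}\eta/\partial t^{m-n;\psi}\partial u^k$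 denotes $\bigl(\tfrac{1}{\psi'(t)}\tfrac{\partial}{\partial t}\bigr)^{m-n}\partial_u^k\eta$ evaluated at $(x,t,u(x,t))$, the infinite sum over $m$ is the limit of its partial sums, and $1/\Gamma$ is zero at the poles of $\Gamma$. This is the nonlinear remainder in the prolongation formula for the $\psi$-Riemann--Liouville derivative of order $\alpha$. Then the following are equivalent: 1. $\mu=0$ identically, i.e. for all such $u$ and all $(x,t)\in\mathbb R\times(a,b)$ the series converges and its sum is $0$; 2. for all such $u$ and all $(x,t)\in\mathbb R\times(a,b)$ at which the series converges, its sum is $0$; 3. $\eta_{uu}(x,t,u)=0$ for all $x\in\mathbb R$, $t\in(a,b)$, $u\in\mathbb R$; 4. $\eta$ is linear in $u$: $\eta(x,t,u)=\theta(x,t)\,u+\rho(x,t)$ for some functions $\theta,\rho$. -/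

import Mathlib

open Set Filter Topology
open scoped ContDiff

/-- The differential operator `D^{1;ψ} = (1 / ψ'(t)) d/dt`, acting on functions of `t`. -/
noncomputable def psiDeriv (ψ : ℝ → ℝ) (f : ℝ → ℝ) : ℝ → ℝ :=
  fun t => (1 / deriv ψ t) * deriv f t

/-- The iterated operator `D^{n;ψ} = ((1 / ψ'(t)) d/dt)^n`. -/
noncomputable def psiDerivIter (ψ : ℝ → ℝ) (n : ℕ) (f : ℝ → ℝ) : ℝ → ℝ :=
  (psiDeriv ψ)^[n] f

/-- The mixed partial derivative `∂^{p+k;ψ} η / ∂t^{p;ψ} ∂u^k` at `(x, t, w)`: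
`k` derivatives in the third variable, then `p` ψ-derivatives in `t`, with `x` and `w` fixed. -/
noncomputable def mixedPsiPartial (ψ : ℝ → ℝ) (η : ℝ → ℝ → ℝ → ℝ) (p k : ℕ) (x t w : ℝ) : ℝ :=
  psiDerivIter ψ p (fun t' => iteratedDeriv k (fun w' => η x t' w') w) t

/-- The `m`-th term (itself a finite sum over `n`, `k`, `r`) of the series `μ`, evaluated along
the function `u = u(x, t)` at the point `(x, t)`. -/
noncomputable def muTerm (α a : ℝ) (ψ : ℝ → ℝ) (η : ℝ → ℝ → ℝ → ℝ) (u : ℝ → ℝ → ℝ)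
    (x t : ℝ) (m : ℕ) : ℝ :=
  ∑ n ∈ Finset.Icc 2 m, ∑ k ∈ Finset.Icc 2 n, ∑ r ∈ Finset.range k,
    Ring.choose α m * (m.choose n : ℝ) * (k.choose r : ℝ) * (1 / (k.factorial : ℝ)) *
      ((ψ t - ψ a) ^ ((m : ℝ) - α) / Real.Gamma ((m : ℝ) + 1 - α)) *
      (-(u x t)) ^ r *
      psiDerivIter ψ n (fun t' => (u x t') ^ (k - r)) t *
      mixedPsiPartial ψ η (m - n) k x t (u x t)

/-- The series `μ = ∑_{m ≥ 2} (m-th term)`, evaluated along `u` at `(x, t)`, converges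
and its sum is `v`. -/
def HasMu (α a : ℝ) (ψ : ℝ → ℝ) (η : ℝ → ℝ → ℝ → ℝ) (u : ℝ → ℝ → ℝ) (x t v : ℝ) : Prop :=
  Tendsto (fun M : ℕ => ∑ m ∈ Finset.Icc 2 M, muTerm α a ψ η u x t m) atTop (𝓝 v)

/-- `u(x, t)`, `x ∈ ℝ`, `t ∈ [a, b]`, is a smooth function of the variables `(x, ψ(t))`. -/
def IsPsiSmooth (a b : ℝ) (ψ : ℝ → ℝ) (u : ℝ → ℝ → ℝ) : Prop :=
  ∃ v : ℝ × ℝ → ℝ, ContDiffOn ℝ ∞ v (univ ×ˢ (ψ '' Icc a b)) ∧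
    ∀ x : ℝ, ∀ t ∈ Icc a b, u x t = v (x, ψ t)

/-- `η(x, t, u)`, `x ∈ ℝ`, `t ∈ (a, b)`, `u ∈ ℝ`, is a smooth function of the variables
`(x, ψ(t), u)`. Nothing is asked of `η` at the endpoints `t = a` and `t = b`. -/
def IsPsiSmoothInfinitesimal (a b : ℝ) (ψ : ℝ → ℝ) (η : ℝ → ℝ → ℝ → ℝ) : Prop :=
  ∃ ζ : ℝ × ℝ × ℝ → ℝ, ContDiffOn ℝ ∞ ζ (univ ×ˢ ((ψ '' Ioo a b) ×ˢ univ)) ∧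
    ∀ x : ℝ, ∀ t ∈ Ioo a b, ∀ w : ℝ, η x t w = ζ (x, ψ t, w)

/-! If `η` is affine in `u`, every term contains a vanishing `u`-derivative of order `k ≥ 2`. The
substance is the converse: where `η_uu ≠ 0`, some `u` makes `μ` converge to a nonzero sum.

Fix `(x, t)` and let `u = v ∘ ψ`. The sum over `r` is a binomial expansion, so the `m`-th term is a
weight times a coefficient built from the powers `p ^ k`, where `p` is the Taylor series of `v` at
`ψ t` without its constant term (`muTerm_eq_muWeight_mul`). With linear coefficient `1`, the `m`-th
such coefficient, `m ≥ 3`, is affine in coefficient `m - 1` of `p`, with slope `m! * η_uu`, and does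
not involve later ones (`remainderCoeff_sub`). Recursion therefore kills every term but the first
one of nonzero weight, and Borel's lemma realizes `p` by a smooth `v`. Convergence is then
automatic: a single term survives. -/

/-! ### Borel's lemma -/

/-- All derivatives of a smooth compactly supported function are bounded. -/
theorem exists_norm_iteratedDeriv_le_of_hasCompactSupport {f : ℝ → ℝ} (hf : ContDiff ℝ ∞ f)
    (hc : HasCompactSupport f) (i : ℕ) : ∃ C, ∀ x, ‖iteratedDeriv i f x‖ ≤ C := by
  obtain ⟨C, hC⟩ := (hc.iteratedFDeriv (𝕜 := ℝ) i).exists_bound_of_continuous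
    (hf.continuous_iteratedFDeriv (by exact_mod_cast le_top))
  exact ⟨C, fun x => by rw [← norm_iteratedFDeriv_eq_norm_iteratedDeriv]; exact hC x⟩

/-- A smooth function with Taylor polynomial `c * x ^ n` at the origin whose derivatives of
order less than `n` are uniformly small. -/
theorem exists_contDiff_eventuallyEq_monomial (n : ℕ) (c : ℝ) {ε : ℝ} (hε : 0 < ε) :
    ∃ f : ℝ → ℝ, ContDiff ℝ ∞ f ∧ f =ᶠ[𝓝 0] (fun x => c * x ^ n) ∧
      (∀ i, ∃ C, ∀ x, ‖iteratedDeriv i f x‖ ≤ C) ∧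
      ∀ i < n, ∀ x, ‖iteratedDeriv i f x‖ ≤ ε := by
  let χ : ContDiffBump (0 : ℝ) := ⟨1, 2, one_pos, one_lt_two⟩
  let φ : ℝ → ℝ := fun x => x ^ n * χ x
  have hφ : ContDiff ℝ ∞ φ := (contDiff_id.pow n).mul χ.contDiff
  have hφc : HasCompactSupport φ := χ.hasCompactSupport.mul_left
  choose M hM using exists_norm_iteratedDeriv_le_of_hasCompactSupport hφ hφc
  have hM0 : ∀ i, 0 ≤ M i := fun i => (norm_nonneg _).trans (hM i 0)
  set S := ∑ i ∈ Finset.range n, M i with hS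
  have hS0 : 0 ≤ S := Finset.sum_nonneg fun i _ => hM0 i
  -- Rescaling by `l` multiplies the `i`-th derivative by `l ^ i / l ^ n`, which is at most `1 / l`
  -- for `i < n`; thus `l ≥ |c| * S / ε` suffices.
  set l : ℝ := 1 + |c| * S / ε with hl
  have hl1 : 1 ≤ l := by rw [hl]; linarith [show 0 ≤ |c| * S / ε by positivity]
  have hl0 : 0 < l := by linarith
  have hder : ∀ i x, iteratedDeriv i (fun x => c * (l⁻¹) ^ n * φ (l * x)) x =
      c * (l⁻¹) ^ n * (l ^ i * iteratedDeriv i φ (l * x)) := by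
    intro i x
    rw [iteratedDeriv_const_mul_field,
      iteratedDeriv_comp_const_mul (hφ.of_le (by exact_mod_cast le_top))]
  refine ⟨fun x => c * (l⁻¹) ^ n * φ (l * x), by fun_prop, ?_, fun i => ?_, fun i hi x => ?_⟩
  · have h1 : ∀ᶠ x in 𝓝 (0 : ℝ), l * x ∈ Metric.ball (0 : ℝ) 1 := by
      have : Tendsto (fun x => l * x) (𝓝 0) (𝓝 0) := by
        simpa using (continuous_const_mul l).tendsto 0
      exact this (Metric.ball_mem_nhds _ one_pos)
    filter_upwards [h1] with x hx
    have : χ (l * x) = 1 := χ.one_of_mem_closedBall (Metric.ball_subset_closedBall hx)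
    simp only [φ, this, mul_pow, inv_pow]
    field_simp
  · refine ⟨|c| * (l⁻¹) ^ n * (l ^ i * M i), fun x => ?_⟩
    rw [hder]
    simp only [norm_mul, norm_pow, norm_inv, Real.norm_eq_abs, abs_of_pos hl0]
    have := hM i (l * x)
    rw [Real.norm_eq_abs] at this
    gcongr
  · rw [hder]
    simp only [norm_mul, norm_pow, norm_inv, Real.norm_eq_abs, abs_of_pos hl0]
    have h1 := hM i (l * x)
    rw [Real.norm_eq_abs] at h1
    have h2 : M i ≤ S := Finset.single_le_sum (f := M) (fun j _ => hM0 j) (Finset.mem_range.2 hi)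
    have h3 : (l⁻¹) ^ n * l ^ i ≤ l⁻¹ := by
      obtain ⟨k, rfl⟩ := Nat.exists_eq_add_of_lt hi
      have : (l⁻¹) ^ (i + k + 1) * l ^ i = l⁻¹ * (l⁻¹) ^ k := by
        simp only [pow_succ, pow_add, inv_pow]; field_simp
      rw [this]
      exact mul_le_of_le_one_right (by positivity)
        (pow_le_one₀ (by positivity) (inv_le_one_of_one_le₀ hl1))
    calc |c| * l⁻¹ ^ n * (l ^ i * |iteratedDeriv i φ (l * x)|)
        = |c| * (l⁻¹ ^ n * l ^ i) * |iteratedDeriv i φ (l * x)| := by ring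
      _ ≤ |c| * l⁻¹ * S := by gcongr; exact h1.trans h2
      _ ≤ ε := by
        rw [mul_assoc, mul_comm l⁻¹, ← mul_assoc, ← div_eq_mul_inv, div_le_iff₀ hl0, hl]
        field_simp
        linarith

/-- **Borel's lemma**: every real sequence is the sequence of derivatives at a point of some
smooth function. -/
theorem exists_contDiff_iteratedDeriv_eq (c : ℕ → ℝ) (s : ℝ) :
    ∃ v : ℝ → ℝ, ContDiff ℝ ∞ v ∧ ∀ n, iteratedDeriv n v s = c n := by
  suffices H : ∃ v : ℝ → ℝ, ContDiff ℝ ∞ v ∧ ∀ n, iteratedDeriv n v 0 = c n by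
    obtain ⟨v, hv, h⟩ := H
    refine ⟨fun z => v (z - s), by fun_prop, fun n => ?_⟩
    rw [iteratedDeriv_comp_sub_const]
    simpa using h n
  choose f hf hf0 hC hsmall using fun n : ℕ =>
    exists_contDiff_eventuallyEq_monomial n (c n / n.factorial) (ε := (1 / 2) ^ n) (by positivity)
  choose C hC using hC
  -- For fixed `k` only the finitely many `i ≤ k` escape the geometric bound.
  let B : ℕ → ℕ → ℝ := fun k i => if k < i then (1 / 2) ^ i else C i k
  have hB : ∀ k, Summable (B k) := by
    intro k
    refine (summable_congr_cofinite ?_).1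
      (summable_geometric_of_lt_one (r := (1 / 2 : ℝ)) (by norm_num) (by norm_num))
    rw [Nat.cofinite_eq_atTop]
    filter_upwards [eventually_gt_atTop k] with i hi
    simp [B, hi]
  have hbound : ∀ (k i : ℕ) (x : ℝ), ‖iteratedFDeriv ℝ k (f i) x‖ ≤ B k i := by
    intro k i x
    rw [norm_iteratedFDeriv_eq_norm_iteratedDeriv]
    by_cases h : k < i
    · simpa [B, h] using hsmall i k h x
    · simpa [B, h] using hC i k x
  refine ⟨fun x => ∑' i, f i x, ?_, fun n => ?_⟩
  · exact contDiff_tsum (N := ⊤) hf (fun k _ => hB k) fun k i x _ => hbound k i x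
  · have hk := iteratedFDeriv_tsum_apply (N := ⊤) hf (fun k _ => hB k)
      (fun k i x _ => hbound k i x) (k := n) le_top 0
    have hs : Summable fun i => iteratedFDeriv ℝ n (f i) 0 :=
      Summable.of_norm_bounded (hB n) fun i => hbound n i 0
    rw [iteratedDeriv_eq_iteratedFDeriv, hk,
      ContinuousMultilinearMap.tsum_eval hs]
    simp_rw [← iteratedDeriv_eq_iteratedFDeriv]
    have hval : ∀ i, iteratedDeriv n (f i) 0 = if i = n then c n else 0 := by
      intro i
      rw [(hf0 i).iteratedDeriv_eq n, iteratedDeriv_const_mul_field, iteratedDeriv_fun_pow_zero]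
      by_cases h : i = n
      · subst h
        have : (i.factorial : ℝ) ≠ 0 := by positivity
        simp [this]
      · simp [h, Ne.symm h]
    simp_rw [hval]
    simp

/-! ### Taylor series of powers and `ψ`-derivatives -/

/-- The Taylor series at `s` of `v`, as a formal power series. -/
noncomputable def taylorPowerSeries (v : ℝ → ℝ) (s : ℝ) : PowerSeries ℝ :=
  PowerSeries.mk fun n => iteratedDeriv n v s / n.factorial

theorem taylorPowerSeries_mul {f g : ℝ → ℝ} (hf : ContDiff ℝ ∞ f) (hg : ContDiff ℝ ∞ g) (s : ℝ) :
    taylorPowerSeries (fun x => f x * g x) s = taylorPowerSeries f s * taylorPowerSeries g s := by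
  ext n
  rw [PowerSeries.coeff_mul, Finset.Nat.sum_antidiagonal_eq_sum_range_succ_mk]
  simp only [taylorPowerSeries, PowerSeries.coeff_mk]
  rw [iteratedDeriv_fun_mul (hf.of_le (by exact_mod_cast le_top)).contDiffAt
    (hg.of_le (by exact_mod_cast le_top)).contDiffAt, Finset.sum_div]
  refine Finset.sum_congr rfl fun i hi => ?_
  rw [Nat.cast_choose ℝ (Nat.lt_succ_iff.1 (Finset.mem_range.1 hi))]
  have := n.factorial_ne_zero
  field_simp

theorem taylorPowerSeries_pow {f : ℝ → ℝ} (hf : ContDiff ℝ ∞ f) (s : ℝ) (k : ℕ) :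
    taylorPowerSeries (fun x => f x ^ k) s = taylorPowerSeries f s ^ k := by
  induction k with
  | zero =>
    ext n
    rcases n with _ | n <;>
      simp [taylorPowerSeries, PowerSeries.coeff_one, iteratedDeriv_const]
  | succ k ih =>
    simp_rw [pow_succ]
    rw [taylorPowerSeries_mul (hf.pow k) hf, ih]

theorem iteratedDeriv_pow_eq_coeff {f : ℝ → ℝ} (hf : ContDiff ℝ ∞ f) (s : ℝ) (k n : ℕ) :
    iteratedDeriv n (fun x => f x ^ k) s =
      n.factorial * PowerSeries.coeff n (taylorPowerSeries f s ^ k) := by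
  rw [← taylorPowerSeries_pow hf]
  have := n.factorial_ne_zero
  simp only [taylorPowerSeries, PowerSeries.coeff_mk]
  field_simp

/-- If `f = g ∘ ψ` on an open set, the iterated `ψ`-derivatives of `f` there are the iterated
derivatives of `g`. -/
theorem psiDerivIter_eq_iteratedDeriv {ψ : ℝ → ℝ} {U : Set ℝ} (hU : IsOpen U)
    (hd : ∀ t ∈ U, DifferentiableAt ℝ ψ t) (hne : ∀ t ∈ U, deriv ψ t ≠ 0) {f g : ℝ → ℝ}
    (hg : ContDiff ℝ ∞ g) (hfg : ∀ t ∈ U, f t = g (ψ t)) (n : ℕ) :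
    ∀ t ∈ U, psiDerivIter ψ n f t = iteratedDeriv n g (ψ t) := by
  induction n with
  | zero => simpa [psiDerivIter] using hfg
  | succ n ih =>
    intro t ht
    have hev : psiDerivIter ψ n f =ᶠ[𝓝 t] (iteratedDeriv n g) ∘ ψ := by
      filter_upwards [hU.mem_nhds ht] with y hy using ih y hy
    have hgd : DifferentiableAt ℝ (iteratedDeriv n g) (ψ t) :=
      (hg.differentiable_iteratedDeriv n (by exact_mod_cast ENat.natCast_lt_top n)) _
    have hn := hne t ht
    rw [psiDerivIter, Function.iterate_succ_apply', ← psiDerivIter, psiDeriv, hev.deriv_eq,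
      deriv_comp t hgd (hd t ht), iteratedDeriv_succ]
    field_simp

/-! ### Prescribing the coefficients recursively -/

/-- A sequence can be defined by prescribing each term as a function of the preceding ones. -/
theorem exists_seq_eq_of_truncation (g : ℕ → (ℕ → ℝ) → ℝ) :
    ∃ c : ℕ → ℝ, ∀ j, c j = g j fun i => if i < j then c i else 0 := by
  let c : ℕ → ℝ := WellFounded.fix (C := fun _ => ℝ) Nat.lt_wfRel.wf
    fun j F => g j fun i => if h : i < j then F i h else 0
  refine ⟨c, fun j => ?_⟩
  have h := WellFounded.fix_eq (C := fun _ => ℝ) Nat.lt_wfRel.wf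
    (fun j F => g j fun i => if h : i < j then F i h else 0) j
  refine h.trans ?_
  congr 1

/-- Changing a power series without constant term from degree `N` on affects the coefficients
of degree at most `N + 1` of its `k`-th power, `k ≥ 2`, only in degree `N + 1` for `k = 2`. -/
theorem coeff_pow_sub_coeff_pow {p q : PowerSeries ℝ} {N n k : ℕ}
    (hp : PowerSeries.X ∣ p) (hq : PowerSeries.X ∣ q)
    (h : (PowerSeries.X : PowerSeries ℝ) ^ N ∣ p - q) (hk : 2 ≤ k) (hn : n ≤ N + 1) :
    PowerSeries.coeff n (p ^ k) - PowerSeries.coeff n (q ^ k) =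
      if n = N + 1 ∧ k = 2 then (PowerSeries.coeff N p - PowerSeries.coeff N q) *
        (PowerSeries.coeff 1 p + PowerSeries.coeff 1 q) else 0 := by
  obtain ⟨p, rfl⟩ := hp
  obtain ⟨q, rfl⟩ := hq
  obtain ⟨δ, hδ⟩ := h
  set Y : PowerSeries ℝ := PowerSeries.X with hY
  -- Here `p` and `q` are already the quotients by `X`. In `Y ^ (k + 2) * (p - q) * ∑ ..`, one
  -- factor `Y` is absorbed to form `Y * p - Y * q = Y ^ N * δ`.
  have hs : ∀ k, (Y * p) ^ (k + 2) - (Y * q) ^ (k + 2) =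
      Y ^ (N + (k + 1)) * (δ * ∑ i ∈ Finset.range (k + 2), p ^ i * q ^ (k + 2 - 1 - i)) := by
    intro k
    rw [mul_pow, mul_pow, ← mul_sub, ← (Commute.all p q).mul_geom_sum₂ (k + 2),
      show Y ^ (k + 2) = Y ^ (k + 1) * Y from pow_succ _ _, pow_add]
    linear_combination (Y ^ (k + 1) *
      ∑ i ∈ Finset.range (k + 2), p ^ i * q ^ (k + 2 - 1 - i)) * hδ
  obtain ⟨k, rfl⟩ := Nat.exists_eq_add_of_le' hk
  rw [← map_sub, hs]
  split_ifs with hc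
  · obtain ⟨rfl, hk⟩ := hc
    obtain rfl : k = 0 := by omega
    rw [← map_sub, hδ, PowerSeries.coeff_X_pow_mul', PowerSeries.coeff_X_pow_mul']
    simp [hY, Finset.sum_range_succ, PowerSeries.coeff_succ_X_mul, add_comm]
  · rw [PowerSeries.coeff_X_pow_mul', if_neg]
    omega

/-- `m!` times the coefficient of `τ ^ m` in `∑_{q, k ≥ 2} b q k / (q! k!) τ ^ q p(τ) ^ k`. -/
noncomputable def remainderCoeff (b : ℕ → ℕ → ℝ) (m : ℕ) (p : PowerSeries ℝ) : ℝ :=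
  ∑ n ∈ Finset.Icc 2 m, ∑ k ∈ Finset.Icc 2 n,
    (m.choose n : ℝ) * (1 / (k.factorial : ℝ)) * (n.factorial * PowerSeries.coeff n (p ^ k)) *
      b (m - n) k

/-- Only the summand `n = N + 1`, `k = 2` sees the change. This is what makes the recursion solvable
when `b 0 2 ≠ 0`. -/
theorem remainderCoeff_sub (b : ℕ → ℕ → ℝ) {N : ℕ} (hN : 1 ≤ N) {p q : PowerSeries ℝ}
    (hp : PowerSeries.X ∣ p) (hq : PowerSeries.X ∣ q)
    (h : (PowerSeries.X : PowerSeries ℝ) ^ N ∣ p - q) :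
    remainderCoeff b (N + 1) p - remainderCoeff b (N + 1) q =
      ((N + 1).factorial : ℝ) / 2 * b 0 2 * (PowerSeries.coeff 1 p + PowerSeries.coeff 1 q) *
        (PowerSeries.coeff N p - PowerSeries.coeff N q) := by
  simp only [remainderCoeff, ← Finset.sum_sub_distrib]
  rw [Finset.sum_eq_single_of_mem (N + 1) (by simp; omega),
    Finset.sum_eq_single_of_mem 2 (by simp; omega)]
  · have := coeff_pow_sub_coeff_pow (k := 2) hp hq h le_rfl (le_refl (N + 1))
    simp only [and_self, if_true] at this
    simp only [Nat.choose_self, Nat.sub_self, Nat.factorial_two]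
    push_cast
    linear_combination ((N + 1).factorial : ℝ) / 2 * b 0 2 * this
  · intro k hk hk2
    have := coeff_pow_sub_coeff_pow hp hq h (Finset.mem_Icc.1 hk).1 (le_refl (N + 1))
    rw [if_neg (by tauto), sub_eq_zero] at this
    rw [this, sub_self]
  · intro n hn hn2
    refine Finset.sum_eq_zero fun k hk => ?_
    have := coeff_pow_sub_coeff_pow hp hq h (Finset.mem_Icc.1 hk).1 (Finset.mem_Icc.1 hn).2
    rw [if_neg (by tauto), sub_eq_zero] at this
    rw [this, sub_self]

theorem remainderCoeff_two (b : ℕ → ℕ → ℝ) {p : PowerSeries ℝ} (hp : PowerSeries.X ∣ p) :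
    remainderCoeff b 2 p = b 0 2 * PowerSeries.coeff 1 p ^ 2 := by
  obtain ⟨p, rfl⟩ := hp
  simp only [remainderCoeff, Finset.Icc_self, Finset.sum_singleton, mul_pow]
  rw [PowerSeries.coeff_X_pow_mul', PowerSeries.coeff_succ_X_mul 0 p]
  simp
  ring

/-- If `b 0 2 ≠ 0`, the numbers `remainderCoeff b m p`, `m ≥ 3`, can be prescribed. -/
theorem exists_remainderCoeff_eq (b : ℕ → ℕ → ℝ) (hb : b 0 2 ≠ 0) (d : ℕ → ℝ) :
    ∃ c : ℕ → ℝ, c 0 = 0 ∧ c 1 = 1 ∧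
      ∀ m, 3 ≤ m → remainderCoeff b m (PowerSeries.mk c) = d m := by
  obtain ⟨c, hc⟩ := exists_seq_eq_of_truncation fun j c' =>
    -- Solution of the affine equation for `c j`: the truncation has `j`-th coefficient `0`, and the
    -- two linear coefficients `1 + 1` cancel the factor `1 / 2`.
    if j = 0 then 0 else if j = 1 then 1 else
      (d (j + 1) - remainderCoeff b (j + 1) (PowerSeries.mk c')) / ((j + 1).factorial * b 0 2)
  have h0 : c 0 = 0 := by rw [hc]; simp
  have h1 : c 1 = 1 := by rw [hc]; simp
  refine ⟨c, h0, h1, fun m hm => ?_⟩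
  obtain ⟨N, rfl⟩ := Nat.exists_eq_add_of_le' (by omega : 1 ≤ m)
  have hN := hc N
  rw [if_neg (by omega), if_neg (by omega)] at hN
  set c' : ℕ → ℝ := fun i => if i < N then c i else 0 with hc'
  have hX : ∀ e : ℕ → ℝ, e 0 = 0 → PowerSeries.X ∣ PowerSeries.mk e := fun e he => by
    rw [PowerSeries.X_dvd_iff]; simpa using he
  have key := remainderCoeff_sub b (N := N) (by omega) (hX c h0) (hX c' (by simp [hc', h0]))
    (by
      rw [PowerSeries.X_pow_dvd_iff]
      intro i hi
      simp [hc', hi])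
  simp only [PowerSeries.coeff_mk] at key
  have e1 : c' 1 = 1 := by rw [hc', ← h1]; simp; omega
  have eN : c' N = 0 := by simp [hc']
  rw [e1, h1, eN, hN] at key
  have : ((N + 1).factorial : ℝ) ≠ 0 := by positivity
  field_simp at key
  linarith

/-! ### The series `μ` along a function of `ψ(t)` -/

/-- The factor of the `m`-th term of the series `μ` which does not depend on `η` and `u`. -/
noncomputable def muWeight (α a : ℝ) (ψ : ℝ → ℝ) (t : ℝ) (m : ℕ) : ℝ :=
  Ring.choose α m * ((ψ t - ψ a) ^ ((m : ℝ) - α) / Real.Gamma ((m : ℝ) + 1 - α))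

theorem muTerm_eq_muWeight_mul {ψ : ℝ → ℝ} {U : Set ℝ} (hU : IsOpen U)
    (hd : ∀ t ∈ U, DifferentiableAt ℝ ψ t) (hne : ∀ t ∈ U, deriv ψ t ≠ 0) {v : ℝ → ℝ}
    (hv : ContDiff ℝ ∞ v) (α a : ℝ) (η : ℝ → ℝ → ℝ → ℝ) (x : ℝ) {t : ℝ} (ht : t ∈ U) (m : ℕ) :
    muTerm α a ψ η (fun _ t' => v (ψ t')) x t m = muWeight α a ψ t m *
      remainderCoeff (fun q k => mixedPsiPartial ψ η q k x t (v (ψ t))) m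
        (taylorPowerSeries v (ψ t) - PowerSeries.C (v (ψ t))) := by
  simp only [muTerm, remainderCoeff, Finset.mul_sum]
  refine Finset.sum_congr rfl fun n hn => Finset.sum_congr rfl fun k hk => ?_
  have hn2 := (Finset.mem_Icc.1 hn).1
  -- The binomial term `r = k`, absent from `μ`, is constant and so has no coefficient in degree `n
  -- ≥ 2`.
  have hexp : PowerSeries.coeff n ((taylorPowerSeries v (ψ t) - PowerSeries.C (v (ψ t))) ^ k) =
      ∑ r ∈ Finset.range k, (k.choose r : ℝ) * (-(v (ψ t))) ^ r *
        PowerSeries.coeff n (taylorPowerSeries v (ψ t) ^ (k - r)) := by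
    rw [sub_eq_neg_add, ← map_neg, add_pow, map_sum, Finset.sum_range_succ, Nat.sub_self, pow_zero,
      mul_one, Nat.choose_self, Nat.cast_one, mul_one, ← map_pow, PowerSeries.coeff_C,
      if_neg (by omega), add_zero]
    refine Finset.sum_congr rfl fun r _ => ?_
    rw [← map_pow, ← map_natCast (PowerSeries.C (R := ℝ)), mul_comm, mul_left_comm,
      PowerSeries.coeff_C_mul, PowerSeries.coeff_C_mul]
    ring
  rw [hexp, Finset.mul_sum, Finset.mul_sum, Finset.sum_mul, Finset.mul_sum]
  refine Finset.sum_congr rfl fun r _ => ?_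
  rw [psiDerivIter_eq_iteratedDeriv hU hd hne (hv.pow (k - r)) (fun t' _ => rfl) n t ht,
    iteratedDeriv_pow_eq_coeff hv, muWeight]
  ring

/-- The first nonvanishing weight: it has index `α` if `α` is a natural number, and `2` if not. -/
theorem exists_muWeight_ne_zero {α a t : ℝ} {ψ : ℝ → ℝ} (hα : 0 < α) (hα1 : α ≠ 1)
    (hψ : ψ a < ψ t) :
    ∃ N : ℕ, 2 ≤ N ∧ muWeight α a ψ t N ≠ 0 ∧
      ∀ m : ℕ, 2 ≤ m → m < N → muWeight α a ψ t m = 0 := by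
  have hpos : 0 < ψ t - ψ a := sub_pos.2 hψ
  by_cases h : ∃ N : ℕ, α = N
  · obtain ⟨N, rfl⟩ := h
    have h0 : 0 < N := by exact_mod_cast hα
    have h1 : N ≠ 1 := by exact_mod_cast hα1
    refine ⟨N, by omega, ?_, fun m _ hm => ?_⟩
    · simp [muWeight, Ring.choose_natCast]
    · have : Real.Gamma ((m : ℝ) + 1 - N) = 0 := by
        rw [Real.Gamma_eq_zero_iff]
        obtain ⟨k, rfl⟩ := Nat.exists_eq_add_of_lt hm
        exact ⟨k, by push_cast; ring⟩
      simp [muWeight, this]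
  · refine ⟨2, le_rfl, ?_, fun m _ _ => by omega⟩
    -- `2 * Ring.choose α 2 = α * (α - 1)`; this is where `α ≠ 1` enters.
    have hch : Ring.choose α 2 ≠ 0 := by
      have h2 := Ring.descPochhammer_eq_factorial_smul_choose α 2
      rw [descPochhammer_succ_right, descPochhammer_one, Polynomial.smeval_mul] at h2
      simp [Polynomial.smeval_sub] at h2
      intro h0
      rw [h0, mul_zero, mul_eq_zero, sub_eq_zero] at h2
      exact h2.elim hα.ne' hα1
    have hG : Real.Gamma (((2 : ℕ) : ℝ) + 1 - α) ≠ 0 := by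
      rw [Ne, Real.Gamma_eq_zero_iff]
      rintro ⟨k, hk⟩
      exact h ⟨k + 3, by push_cast at hk ⊢; linarith⟩
    exact mul_ne_zero hch (div_ne_zero (Real.rpow_pos_of_pos hpos _).ne' hG)

/-- If `η_uu ≠ 0` at some point, then along a suitable `u` the series `μ` converges there to a
nonzero sum. -/
theorem exists_hasMu_ne_zero {ψ : ℝ → ℝ} {U : Set ℝ} (hU : IsOpen U)
    (hd : ∀ t ∈ U, DifferentiableAt ℝ ψ t) (hne : ∀ t ∈ U, deriv ψ t ≠ 0) {α a x t w : ℝ}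
    (hα : 0 < α) (hα1 : α ≠ 1) {η : ℝ → ℝ → ℝ → ℝ} (ht : t ∈ U) (hψ : ψ a < ψ t)
    (hη : iteratedDeriv 2 (fun w' => η x t w') w ≠ 0) :
    ∃ v : ℝ → ℝ, ContDiff ℝ ∞ v ∧ ∃ y, y ≠ 0 ∧
      HasMu α a ψ η (fun _ t' => v (ψ t')) x t y := by
  obtain ⟨N, hN2, hN, hlt⟩ := exists_muWeight_ne_zero hα hα1 hψ
  obtain ⟨c, hc0, hc1, hc⟩ := exists_remainderCoeff_eq
    (fun q k => mixedPsiPartial ψ η q k x t w) (by simpa [mixedPsiPartial, psiDerivIter] using hη)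
    (fun m => if m = N then 1 else 0)
  obtain ⟨v, hv, hvc⟩ := exists_contDiff_iteratedDeriv_eq
    (fun n => if n = 0 then w else n.factorial * c n) (ψ t)
  have hvw : v (ψ t) = w := by simpa using hvc 0
  have hT : taylorPowerSeries v (ψ t) - PowerSeries.C (v (ψ t)) = PowerSeries.mk c := by
    ext n
    rw [map_sub, taylorPowerSeries, PowerSeries.coeff_mk, PowerSeries.coeff_mk, hvc, hvw,
      PowerSeries.coeff_C]
    by_cases hn : n = 0
    · simp [hn, hc0]
    · have := n.factorial_ne_zero
      simp only [hn, if_false]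
      field_simp
      ring
  set R := fun m => remainderCoeff (fun q k => mixedPsiPartial ψ η q k x t w) m (PowerSeries.mk c)
    with hR
  have hterm : ∀ m, muTerm α a ψ η (fun _ t' => v (ψ t')) x t m = muWeight α a ψ t m * R m := by
    intro m
    rw [muTerm_eq_muWeight_mul hU hd hne hv α a η x ht m, hT, hvw]
  have hRN : R N ≠ 0 := by
    -- The coefficient of index `2` cannot be prescribed: it is `η_uu`. If `N = 2` it is the
    -- surviving one; if `N > 2` its weight vanishes.
    rcases hN2.eq_or_lt with rfl | h3
    · simp only [hR]
      rw [remainderCoeff_two _ (by rw [PowerSeries.X_dvd_iff]; simpa using hc0)]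
      simpa [hc1, mixedPsiPartial, psiDerivIter] using hη
    · simp [hR, hc N h3]
  refine ⟨v, hv, muWeight α a ψ t N * R N, mul_ne_zero hN hRN, ?_⟩
  refine tendsto_const_nhds.congr' ?_
  filter_upwards [eventually_ge_atTop N] with M hM
  rw [Finset.sum_eq_single_of_mem N (Finset.mem_Icc.2 ⟨hN2, hM⟩), hterm]
  intro m hm hmN
  have hm2 := (Finset.mem_Icc.1 hm).1
  rw [hterm]
  rcases lt_or_gt_of_ne hmN with h | h
  · rw [hlt m hm2 h, zero_mul]
  · rw [show R m = 0 by simp [hR, hc m (by omega), hmN], mul_zero]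

/-! ### Affine `η` and the equivalence -/

/-- The `u`-derivatives are taken first and already vanish throughout `U`, so no regularity of `θ`
and `ρ` in `t` is needed. -/
theorem mixedPsiPartial_eq_zero_of_affine {ψ : ℝ → ℝ} {U : Set ℝ} (hU : IsOpen U)
    (hd : ∀ t ∈ U, DifferentiableAt ℝ ψ t) (hne : ∀ t ∈ U, deriv ψ t ≠ 0)
    {η : ℝ → ℝ → ℝ → ℝ} {x t : ℝ} {θ ρ : ℝ → ℝ} (ht : t ∈ U)
    (hη : ∀ t ∈ U, ∀ w, η x t w = θ t * w + ρ t) {k : ℕ} (hk : 2 ≤ k) (q : ℕ) (w : ℝ) :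
    mixedPsiPartial ψ η q k x t w = 0 := by
  rw [mixedPsiPartial, psiDerivIter_eq_iteratedDeriv hU hd hne (g := fun _ => 0) contDiff_const
    ?_ q t ht, iteratedDeriv_fun_const_zero]
  intro t' ht'
  obtain ⟨k, rfl⟩ := Nat.exists_eq_add_of_le' hk
  have h1 : deriv (fun w' => η x t' w') = fun _ => θ t' := by
    funext y
    rw [show (fun w' => η x t' w') = fun w' => θ t' * w' + ρ t' from funext (hη t' ht')]
    simp
  rw [iteratedDeriv_succ', h1, iteratedDeriv_succ', deriv_const', iteratedDeriv_fun_const_zero]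

theorem eq_affine_of_iteratedDeriv_two_eq_zero {f : ℝ → ℝ} (hf : ContDiff ℝ ∞ f)
    (h : ∀ w, iteratedDeriv 2 f w = 0) (w : ℝ) : f w = deriv f 0 * w + f 0 := by
  have h1 : ∀ y, deriv f y = deriv f 0 := by
    have hd : Differentiable ℝ (deriv f) := by
      simpa using hf.differentiable_iteratedDeriv 1 (by exact_mod_cast ENat.natCast_lt_top 1)
    refine fun y => is_const_of_deriv_eq_zero hd (fun z => ?_) y 0
    simpa [iteratedDeriv_succ] using h z
  have hg : ∀ y, HasDerivAt (fun y => f y - deriv f 0 * y) 0 y := fun y => by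
    have := ((hf.differentiable (by norm_num) y).hasDerivAt).sub
      ((hasDerivAt_id y).const_mul (deriv f 0))
    rw [h1 y, mul_one, sub_self] at this
    exact this
  have := is_const_of_deriv_eq_zero (fun y => (hg y).differentiableAt) (fun y => (hg y).deriv) w 0
  simp at this
  linarith

theorem mainTheorem5 (α a b : ℝ) (hα : 0 < α) (hα1 : α ≠ 1) (hab : a < b)
    (ψ : ℝ → ℝ) (hψ : ContDiffOn ℝ 1 ψ (Icc a b)) (hψmono : StrictMonoOn ψ (Icc a b))
    (hψ' : ∀ t ∈ Icc a b, derivWithin ψ (Icc a b) t ≠ 0)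
    (η : ℝ → ℝ → ℝ → ℝ) (hη : IsPsiSmoothInfinitesimal a b ψ η) :
    List.TFAE [
      -- `μ = 0`: along every `u` and at every point the series `μ` converges to zero
      ∀ u : ℝ → ℝ → ℝ, IsPsiSmooth a b ψ u → ∀ x : ℝ, ∀ t ∈ Ioo a b,
        HasMu α a ψ η u x t 0,
      -- `μ = 0`: the series `μ` has the sum zero wherever it converges
      ∀ u : ℝ → ℝ → ℝ, IsPsiSmooth a b ψ u → ∀ x : ℝ, ∀ t ∈ Ioo a b, ∀ v : ℝ,
        HasMu α a ψ η u x t v → v = 0,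
      -- `η_uu = 0`
      ∀ x : ℝ, ∀ t ∈ Ioo a b, ∀ w : ℝ, iteratedDeriv 2 (fun w' => η x t w') w = 0,
      -- `η` is linear with respect to `u`
      ∃ θ ρ : ℝ → ℝ → ℝ, ∀ x : ℝ, ∀ t ∈ Ioo a b, ∀ w : ℝ, η x t w = θ x t * w + ρ x t] := by
  have hd : ∀ t ∈ Ioo a b, DifferentiableAt ℝ ψ t := fun t ht =>
    (hψ.differentiableOn (by norm_num) t (Ioo_subset_Icc_self ht)).differentiableAt
      (Icc_mem_nhds ht.1 ht.2)
  have hne : ∀ t ∈ Ioo a b, deriv ψ t ≠ 0 := fun t ht => by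
    rw [← derivWithin_of_mem_nhds (Icc_mem_nhds ht.1 ht.2)]
    exact hψ' t (Ioo_subset_Icc_self ht)
  tfae_have 1 → 2 := fun h u hu x t ht v hv => tendsto_nhds_unique hv (h u hu x t ht)
  tfae_have 2 → 3 := by
    intro h x t ht w
    by_contra hw
    obtain ⟨v, hv, y, hy, hmu⟩ := exists_hasMu_ne_zero isOpen_Ioo hd hne hα hα1 ht
      (hψmono (left_mem_Icc.2 hab.le) (Ioo_subset_Icc_self ht) ht.1) hw
    refine hy (h _ ⟨fun p => v p.2, ?_, fun _ _ _ => rfl⟩ x t ht y hmu)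
    exact (hv.comp contDiff_snd).contDiffOn
  tfae_have 3 → 4 := by
    intro h
    refine ⟨fun x t => deriv (fun w' => η x t w') 0, fun x t => η x t 0, fun x t ht w => ?_⟩
    -- Smoothness in `w` is essential here: `iteratedDeriv` could be zero by default for a nonsmooth
    -- function.
    obtain ⟨ζ, hζ, hηζ⟩ := hη
    refine eq_affine_of_iteratedDeriv_two_eq_zero ?_ (h x t ht) w
    rw [show (fun w' => η x t w') = fun w' => ζ (x, ψ t, w') from funext (hηζ x t ht),
      ← contDiffOn_univ]
    refine hζ.comp (g := ζ) (f := fun w' => (x, ψ t, w'))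
      (by fun_prop) fun w' _ => ⟨mem_univ _, mem_image_of_mem ψ ht, mem_univ _⟩
  tfae_have 4 → 1 := by
    rintro ⟨θ, ρ, h⟩ u _ x t ht
    have h0 : ∀ m, muTerm α a ψ η u x t m = 0 := fun m =>
      Finset.sum_eq_zero fun n _ => Finset.sum_eq_zero fun k hk => Finset.sum_eq_zero fun r _ => by
        rw [mixedPsiPartial_eq_zero_of_affine isOpen_Ioo hd hne ht (h x) (Finset.mem_Icc.1 hk).1,
          mul_zero]
    simp [HasMu, h0]
  tfae_finish
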